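/- Let $X$ be a real Banach space which is nearly uniformly convex, that is: $X$ is reflexive and its norm is uniformly Kadec--Klee, meaning that for every $\epsilon>0$ there is $\delta>0$ such that whenever $(x_n)$ is a sequence in the closed unit ball of $X$ converging weakly to $x_0$ and $\inf\{\|x_n-x_m\| : n\neq m\}>\epsilon$, one has $\|x_0\|\le 1-\delta$. Let $A,B\subseteq X$ be nonempty, bounded, closed and convex, and put $\operatorname{dist}(A,B)=\inf\{\|a-b\| : a\in A,\ b\in B\}$. Assume: (i) $(A,B)$ is a proximal parallel pair: for each $(x,y)\in A\times B$ there is a unique pair $(x_1,y_1)\in A\times B$ with $\|x-y_1\|=\operatorname{dist}(A,B)=\|y-x_1\|$, and there is a unique $h\in X$ with $B=A+h$; (ii) $(A,B)$ has the rectangle property: $\|x+h-y\|=\|y+h-x\|$ for all $x,y\in A$, with $h$ as in (i); (iii) $(A,B)$ has property $UC$: if $(x_n),(z_n)$ are sequences in $A$ and $(y_n)$ is a sequence in $B$ with $\lim\|x_n-y_n\|=\operatorname{dist}(A,B)=\lim\|z_n-y_n\|$, then $\lim\|x_n-z_n\|=0$. Let $T:A\cup B\to A\cup B$ be a continuous map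 with $T(A)\subseteq B$ and $T(B)\subseteq A$ which is asymptotically relatively nonexpansive: there is a sequence $(k_n)$ in $[1,\infty)$ with $\lim k_n=1$ and $\|T^nx-T^ny\|\le k_n\|x-y\|$ for all $n$, all $x\in A$ and all $y\in B$. Then there exists $x\in A\cup B$ such that $\|x-Tx\|=\operatorname{dist}(A,B)$. -/

import Mathlib

open Filter Topology

noncomputable section

namespace BestProximity

variable {X : Type*} [NormedAddCommGroup X]

/-- The distance `dist(A, B) = inf {‖a - b‖ : a ∈ A, b ∈ B}` between two (nonempty) sets. -/
def setDist (A B : Set X) : ℝ :=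
  sInf {r : ℝ | ∃ a ∈ A, ∃ b ∈ B, r = ‖a - b‖}

/-- The separation `sep{xₙ} = inf {‖xₙ - xₘ‖ : n ≠ m}` of a sequence. -/
def sep (x : ℕ → X) : ℝ :=
  sInf {r : ℝ | ∃ n m : ℕ, n ≠ m ∧ r = ‖x n - x m‖}

/-- The norm of `X` is uniformly Kadec-Klee. Weak convergence is convergence in
`WeakSpace ℝ X`. -/
def IsUKK (X : Type*) [NormedAddCommGroup X] [NormedSpace ℝ X] : Prop :=
  ∀ ε : ℝ, 0 < ε → ∃ δ : ℝ, 0 < δ ∧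
    ∀ (x : ℕ → X) (x₀ : X),
      (∀ n, ‖x n‖ ≤ 1) →
      Tendsto (fun n => toWeakSpace ℝ X (x n)) atTop (𝓝 (toWeakSpace ℝ X x₀)) →
      ε < sep x →
      ‖x₀‖ ≤ 1 - δ

/-- `X` is reflexive: the canonical map into the topological bidual is onto. -/
def IsReflexiveSpace (X : Type*) [NormedAddCommGroup X] [NormedSpace ℝ X] : Prop :=
  Function.Surjective (NormedSpace.inclusionInDoubleDual ℝ X)

/-- Nearly uniformly convex: reflexive with a uniformly Kadec-Klee norm. -/
def IsNUC (X : Type*) [NormedAddCommGroup X] [NormedSpace ℝ X] : Prop :=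
  IsReflexiveSpace X ∧ IsUKK X

/-- Sharp proximal pair: for each `(x, y) ∈ A × B` there is exactly one `(x₁, y₁) ∈ A × B`
with `‖x - y₁‖ = dist(A, B) = ‖y - x₁‖`. -/
def IsSharpProximalPair (A B : Set X) : Prop :=
  ∀ x ∈ A, ∀ y ∈ B, ∃! p : X × X,
    (p.1 ∈ A ∧ p.2 ∈ B) ∧ ‖x - p.2‖ = setDist A B ∧ ‖y - p.1‖ = setDist A B

/-- `B` is the translate `A + h`. -/
def IsTranslate (A B : Set X) (h : X) : Prop :=
  B = (fun a => a + h) '' A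

/-- Proximal parallel pair: a sharp proximal pair with `B = A + h` for a unique `h`. -/
def IsProximalParallelPair (A B : Set X) : Prop :=
  IsSharpProximalPair A B ∧ ∃! h : X, IsTranslate A B h

/-- Rectangle property: `‖x + h - y‖ = ‖y + h - x‖` for all `x, y ∈ A`, where `B = A + h`
(the vector `h` is unique for a proximal parallel pair). -/
def HasRectangleProperty (A B : Set X) : Prop :=
  ∃ h : X, IsTranslate A B h ∧ ∀ x ∈ A, ∀ y ∈ A, ‖x + h - y‖ = ‖y + h - x‖

/-- Property UC. -/
def HasPropertyUC (A B : Set X) : Prop :=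
  ∀ x z y : ℕ → X, (∀ n, x n ∈ A) → (∀ n, z n ∈ A) → (∀ n, y n ∈ B) →
    Tendsto (fun n => ‖x n - y n‖) atTop (𝓝 (setDist A B)) →
    Tendsto (fun n => ‖z n - y n‖) atTop (𝓝 (setDist A B)) →
    Tendsto (fun n => ‖x n - z n‖) atTop (𝓝 0)

/-- `T` is asymptotically relatively nonexpansive on `A ∪ B`: there are `kₙ ≥ 1`, `kₙ → 1`,
with `‖Tⁿ x - Tⁿ y‖ ≤ kₙ ‖x - y‖` for `x ∈ A`, `y ∈ B`. Only values of `T` on `A ∪ B` matter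
when `T` maps `A ∪ B` into itself. -/
def IsAsympRelNonexpansive (A B : Set X) (T : X → X) : Prop :=
  ∃ k : ℕ → ℝ, (∀ n, 1 ≤ k n) ∧ Tendsto k atTop (𝓝 1) ∧
    ∀ n, ∀ x ∈ A, ∀ y ∈ B, ‖T^[n] x - T^[n] y‖ ≤ k n * ‖x - y‖

end BestProximity

end

noncomputable section

namespace BestProximity

/-! ### Weak sequential compactness in reflexive spaces -/

section Weak

variable {X : Type*} [NormedAddCommGroup X] [NormedSpace ℝ X]

/-! Translating the odd iterates of `T` back by `h` turns the orbit of `x ∈ A` into a sequence `a x`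
in `A`. The rectangle property makes the gauge `‖x - y - h‖` symmetric on `A`; its minimum there is
`‖h‖ = dist(A, B)`. The orbits are asymptotically nonexpansive for this gauge, up to an error that
property UC sends to zero (`norm_projectedOrbit_sub_le`, `tendsto_norm_projectedOrbit_sub_dual`).

Let `K` be a minimal nonempty closed convex subset of `A` containing the weak cluster points of its
orbits. For `x ∈ K`, minimality makes `limsup ‖a x n - y - h‖` a constant `ρ` over `y ∈ K`. If `ρ ≤
‖h‖`, UC gives `a x n → x`, and continuity gives `T x = x + h`. If `ρ > ‖h‖`, averaging cluster
points shows that the orbit is not totally bounded, so it has a separated subsequence with a weak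
limit `z ∈ K`. The uniform Kadec-Klee property then puts `z` at asymptotic distance less than `ρ`, a
contradiction. -/

theorem _root_.Convex.isClosed_image_toWeakSpace {s : Set X} (hs : Convex ℝ s)
    (hc : IsClosed s) : IsClosed (toWeakSpace ℝ X '' s) := by
  rw [← closure_eq_iff_isClosed, ← hs.toWeakSpace_closure ℝ, hc.closure_eq]

theorem _root_.Convex.mem_of_mapClusterPt_toWeakSpace {s : Set X} (hs : Convex ℝ s)
    (hc : IsClosed s) {u : ℕ → X} (hu : ∀ᶠ n in atTop, u n ∈ s) {z : X}
    (hz : MapClusterPt (toWeakSpace ℝ X z) atTop (fun n => toWeakSpace ℝ X (u n))) : z ∈ s := by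
  have h1 : toWeakSpace ℝ X z ∈ toWeakSpace ℝ X '' s := by
    refine (hs.isClosed_image_toWeakSpace hc).mem_of_mapClusterPt hz ?_
    exact hu.mono fun n hn => ⟨_, hn, rfl⟩
  obtain ⟨y, hy, hyz⟩ := h1
  rwa [← (toWeakSpace ℝ X).injective hyz]

theorem IsReflexiveSpace.isCompact_image_toWeakSpace (hX : IsReflexiveSpace X) {s : Set X}
    (hs : Convex ℝ s) (hc : IsClosed s) (hb : Bornology.IsBounded s) :
    IsCompact (toWeakSpace ℝ X '' s) := by
  rw [← (hs.isClosed_image_toWeakSpace hc).closure_eq]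
  refine NormedSpace.isCompact_closure_of_isBounded ℝ X _ ?_ ?_
  · rwa [Set.preimage_image_eq _ (toWeakSpace ℝ X).injective]
  · intro φ _
    obtain ⟨x, hx⟩ := hX (WeakDual.toStrongDual φ)
    refine ⟨toWeakSpace ℝ X x, ?_⟩
    exact DFunLike.ext _ _ fun f => congrArg (fun g => g f) hx

/-- A bounded sequence in a reflexive space has a weakly convergent subsequence. -/
theorem IsReflexiveSpace.exists_subseq_tendsto_weak (hX : IsReflexiveSpace X) {u : ℕ → X}
    (hu : Bornology.IsBounded (Set.range u)) :
    ∃ (z : X) (φ : ℕ → ℕ), StrictMono φ ∧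
      Tendsto (fun n => toWeakSpace ℝ X (u (φ n))) atTop (𝓝 (toWeakSpace ℝ X z)) := by
  -- The closed span of the sequence is separable, so countably many norming functionals separate
  -- its points. They metrize the weakly compact set `s`, where compactness becomes sequential.
  set Y : Submodule ℝ X := (Submodule.span ℝ (Set.range u)).topologicalClosure with hY
  have huY : ∀ n, u n ∈ Y := fun n =>
    Submodule.le_topologicalClosure _ (Submodule.subset_span ⟨n, rfl⟩)
  have hYsep : TopologicalSpace.IsSeparable (Y : Set X) := by
    rw [hY, Submodule.topologicalClosure_coe]
    exact ((Set.countable_range u).isSeparable.span (R := ℝ)).closure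
  obtain ⟨R, hR⟩ := hu.subset_closedBall 0
  set s : Set X := (Y : Set X) ∩ Metric.closedBall 0 R with hs
  have hsconv : Convex ℝ s := Y.convex.inter (convex_closedBall _ _)
  have hsc : IsClosed s :=
    (Submodule.isClosed_topologicalClosure _).inter Metric.isClosed_closedBall
  have hsb : Bornology.IsBounded s := Metric.isBounded_closedBall.subset Set.inter_subset_right
  have hcomp := hX.isCompact_image_toWeakSpace hsconv hsc hsb
  have : TopologicalSpace.SeparableSpace Y := hYsep.separableSpace
  choose g hg1 hg2 using fun x : X => exists_dual_vector'' ℝ x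
  let f : ℕ → StrongDual ℝ X := fun i => g (TopologicalSpace.denseSeq Y i)
  have hsepf : ∀ y ∈ Y, (∀ i, f i y = 0) → y = 0 := by
    intro y hy hfy
    by_contra hne
    have hpos : 0 < ‖y‖ := norm_pos_iff.mpr hne
    obtain ⟨_, hq, i, rfl⟩ := Metric.dense_iff.mp (TopologicalSpace.denseRange_denseSeq Y)
      (⟨y, hy⟩ : Y) (‖y‖ / 2) (by positivity)
    set q : X := (TopologicalSpace.denseSeq Y i : X) with hqdef
    have hdist : ‖q - y‖ < ‖y‖ / 2 := by
      simpa [Subtype.dist_eq, dist_eq_norm] using hq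
    have h1 : f i q = ‖q‖ := hg2 q
    have h2 : ‖f i (q - y)‖ ≤ ‖q - y‖ :=
      ((f i).le_opNorm _).trans (mul_le_of_le_one_left (norm_nonneg _) (hg1 _))
    rw [map_sub, hfy i, sub_zero, h1, norm_norm] at h2
    have h3 : ‖y‖ ≤ ‖q‖ + ‖q - y‖ := by
      have := norm_sub_le q (q - y)
      simpa using this
    linarith
  set K : Set (WeakSpace ℝ X) := toWeakSpace ℝ X '' s with hK
  have : CompactSpace K := isCompact_iff_compactSpace.mp hcomp
  have : TopologicalSpace.MetrizableSpace K := by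
    refine Metric.PiNatEmbed.TopologicalSpace.MetrizableSpace.of_countable_separating
      (fun i (k : K) => f i ((toWeakSpace ℝ X).symm k)) (fun i => ?_) ?_
    · exact (WeakBilin.eval_continuous (topDualPairing ℝ X).flip (f i)).comp
        continuous_subtype_val
    · rintro ⟨_, x, hx, rfl⟩ ⟨_, y, hy, rfl⟩ hxy
      by_contra! hcon
      apply hxy
      have : x - y = 0 := hsepf _ (Y.sub_mem hx.1 hy.1) fun i => by
        have := hcon i
        simp only [LinearEquiv.symm_apply_apply] at this
        rw [map_sub, this, sub_self]
      rw [sub_eq_zero] at this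
      subst this
      rfl
  let v : ℕ → K := fun n => ⟨toWeakSpace ℝ X (u n), u n, ⟨huY n, hR ⟨n, rfl⟩⟩, rfl⟩
  obtain ⟨⟨_, z, hz, rfl⟩, φ, hφ, hlim⟩ := CompactSpace.tendsto_subseq v
  exact ⟨z, φ, hφ, (continuous_subtype_val.tendsto _).comp hlim⟩

end Weak

/-- A sequence without totally bounded range has uniformly separated values along some
index sequence tending to infinity. -/
theorem exists_separated_of_not_totallyBounded {X : Type*} [PseudoMetricSpace X] {u : ℕ → X}
    (hu : ¬ TotallyBounded (Set.range u)) :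
    ∃ s > 0, ∃ φ : ℕ → ℕ, Tendsto φ atTop atTop ∧
      ∀ i j, i ≠ j → s ≤ dist (u (φ i)) (u (φ j)) := by
  simp only [Metric.totallyBounded_iff, not_forall, not_exists, not_and] at hu
  obtain ⟨s, hs, hcov⟩ := hu
  obtain ⟨φ, -, hφ⟩ := exists_seq_of_forall_finset_exists (fun _ : ℕ => True)
    (fun i j => s ≤ dist (u j) (u i)) (fun t _ => by
      have := hcov (u '' t) (t.finite_toSet.image u)
      rw [Set.not_subset] at this
      obtain ⟨_, ⟨n, rfl⟩, hn⟩ := this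
      refine ⟨n, trivial, fun i hi => ?_⟩
      simp only [Set.mem_iUnion, Metric.mem_ball, not_exists, not_lt] at hn
      exact hn _ ⟨i, hi, rfl⟩)
  have hφ' : ∀ i j, i ≠ j → s ≤ dist (u (φ i)) (u (φ j)) := by
    intro i j hij
    rcases lt_or_gt_of_ne hij with h | h
    · rw [dist_comm]; exact hφ _ _ h
    · exact hφ _ _ h
  refine ⟨s, hs, φ, ?_, hφ'⟩
  have hinj : Function.Injective φ := by
    intro i j hij
    by_contra hne
    have := hφ' i j hne
    rw [hij, dist_self] at this
    linarith
  rw [← Nat.cofinite_eq_atTop]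
  exact hinj.tendsto_cofinite

/-! ### Asymptotic distance to an orbit, minimal sets, and the Kadec-Klee estimate -/

section AsymptoticCentre

variable {X : Type*} [NormedAddCommGroup X]

/-- The points `y` with `limsup ‖uₙ - y - h‖ ≤ r`. -/
def asymptoticSublevel (u : ℕ → X) (h : X) (r : ℝ) : Set X :=
  {y | ∀ c > r, ∀ᶠ n in atTop, ‖u n - y - h‖ ≤ c}

theorem isClosed_asymptoticSublevel (u : ℕ → X) (h : X) (r : ℝ) :
    IsClosed (asymptoticSublevel u h r) := by
  refine isClosed_of_closure_subset fun y hy c hc => ?_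
  obtain ⟨y', hy', hyy⟩ := Metric.mem_closure_iff.mp hy ((c - r) / 2) (by linarith)
  rw [dist_eq_norm] at hyy
  filter_upwards [hy' ((c + r) / 2) (by linarith)] with n hn
  have : ‖u n - y - h‖ ≤ ‖u n - y' - h‖ + ‖y - y'‖ := by
    have := norm_sub_le (u n - y' - h) (y - y')
    rwa [show u n - y' - h - (y - y') = u n - y - h by abel] at this
  linarith

variable [NormedSpace ℝ X]

theorem convex_asymptoticSublevel (u : ℕ → X) (h : X) (r : ℝ) :
    Convex ℝ (asymptoticSublevel u h r) := by
  intro x hx y hy α β hα hβ hαβ c hc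
  filter_upwards [hx c hc, hy c hc] with n hn hn'
  have heq : u n - (α • x + β • y) - h = α • (u n - x - h) + β • (u n - y - h) := by
    have h1 : u n = α • u n + β • u n := by rw [← add_smul, hαβ, one_smul]
    have h2 : h = α • h + β • h := by rw [← add_smul, hαβ, one_smul]
    nth_rewrite 1 [h1]
    nth_rewrite 1 [h2]
    module
  rw [heq]
  calc ‖α • (u n - x - h) + β • (u n - y - h)‖
      ≤ ‖α • (u n - x - h)‖ + ‖β • (u n - y - h)‖ := norm_add_le _ _
    _ = α * ‖u n - x - h‖ + β * ‖u n - y - h‖ := by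
        rw [norm_smul, norm_smul, Real.norm_of_nonneg hα, Real.norm_of_nonneg hβ]
    _ ≤ α * c + β * c := by gcongr
    _ = c := by rw [← add_mul, hαβ, one_mul]

/-- `K` contains the weak cluster points of the orbits `a x` of its points. -/
def ContainsWeakOmegaLimits (a : X → ℕ → X) (K : Set X) : Prop :=
  ∀ x ∈ K, ∀ z, MapClusterPt (toWeakSpace ℝ X z) atTop (fun n => toWeakSpace ℝ X (a x n)) → z ∈ K

/-- The nonempty closed convex subsets of `A` that contain the weak `ω`-limits of their points. -/
def omegaClosedSubsets (A : Set X) (a : X → ℕ → X) : Set (Set X) :=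
  {K | K ⊆ A ∧ K.Nonempty ∧ IsClosed K ∧ Convex ℝ K ∧ ContainsWeakOmegaLimits a K}

theorem IsReflexiveSpace.exists_minimal_omegaClosed (hX : IsReflexiveSpace X) {A : Set X}
    (hA : A.Nonempty) (hAc : IsClosed A) (hAconv : Convex ℝ A) (hAb : Bornology.IsBounded A)
    {a : X → ℕ → X} (ha : ∀ x ∈ A, ∀ n, a x n ∈ A) :
    ∃ K, Minimal (· ∈ omegaClosedSubsets A a) K := by
  have hAmem : A ∈ omegaClosedSubsets A a :=
    ⟨subset_rfl, hA, hAc, hAconv, fun x hx z hz =>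
      hAconv.mem_of_mapClusterPt_toWeakSpace hAc (Eventually.of_forall (ha x hx)) hz⟩
  obtain ⟨K, -, hK⟩ := zorn_superset_nonempty (omegaClosedSubsets A a) (fun c hc hchain hne => by
    refine ⟨⋂₀ c, ⟨?_, ?_, isClosed_sInter fun s hs => (hc hs).2.2.1,
      convex_sInter fun s hs => (hc hs).2.2.2.1, ?_⟩, fun s hs => Set.sInter_subset_of_mem hs⟩
    · obtain ⟨s, hs⟩ := hne
      exact (Set.sInter_subset_of_mem hs).trans (hc hs).1
    -- Members of the chain are weakly compact, so their intersection is nonempty.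
    · have hcomp : ∀ s ∈ c, IsCompact (toWeakSpace ℝ X '' s) := fun s hs =>
        hX.isCompact_image_toWeakSpace (hc hs).2.2.2.1 (hc hs).2.2.1 (hAb.subset (hc hs).1)
      have : Nonempty ((fun s => toWeakSpace ℝ X '' s) '' c) := (hne.image _).to_subtype
      obtain ⟨w, hw⟩ := IsCompact.nonempty_sInter_of_directed_nonempty_isCompact_isClosed
        (S := (fun s => toWeakSpace ℝ X '' s) '' c) (by
          rintro _ ⟨s, hs, rfl⟩ _ ⟨t, ht, rfl⟩
          rcases hchain.total hs ht with hst | hst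
          · exact ⟨_, ⟨s, hs, rfl⟩, subset_rfl, Set.image_mono hst⟩
          · exact ⟨_, ⟨t, ht, rfl⟩, Set.image_mono hst, subset_rfl⟩)
        (by rintro _ ⟨s, hs, rfl⟩; exact (hc hs).2.1.image _)
        (by rintro _ ⟨s, hs, rfl⟩; exact hcomp s hs)
        (by
          rintro _ ⟨s, hs, rfl⟩
          exact (hc hs).2.2.2.1.isClosed_image_toWeakSpace (hc hs).2.2.1)
      refine ⟨(toWeakSpace ℝ X).symm w, fun s hs => ?_⟩
      obtain ⟨x, hx, rfl⟩ := hw _ ⟨s, hs, rfl⟩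
      simpa using hx
    · intro x hx z hz s hs
      exact (hc hs).2.2.2.2 x (hx s hs) z hz) A hAmem
  exact ⟨K, hK⟩

/-- A sequence with totally bounded range cannot be asymptotically equidistant, at a distance
exceeding `‖h‖`, from the translates `y + h` of the points of a convex set that contains its
cluster points. -/
theorem not_totallyBounded_of_asymptotically_equidistant [CompleteSpace X] {u : ℕ → X} {K : Set X}
    (hK : Convex ℝ K) (hu : ∀ w, MapClusterPt w atTop u → w ∈ K) {h : X} {ρ : ℝ} (hρ : ‖h‖ < ρ)
    (hle : ∀ y ∈ K, ∀ c > ρ, ∀ᶠ n in atTop, ‖u n - y - h‖ ≤ c)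
    (hge : ∀ y ∈ K, ∀ c < ρ, ∃ᶠ n in atTop, c < ‖u n - y - h‖) :
    ¬ TotallyBounded (Set.range u) := by
  intro htb
  have hcomp : IsCompact (closure (Set.range u)) :=
    htb.closure.isCompact_of_isClosed isClosed_closure
  set W : Set X := {w | MapClusterPt w atTop u} with hW
  have hWtb : TotallyBounded W := htb.closure.subset fun w hw =>
    isClosed_closure.mem_of_mapClusterPt hw
      (Eventually.of_forall fun n => subset_closure (Set.mem_range_self n))
  -- Each late `u n` is `η`-close to some net point, whose term is then at most `‖h‖ + η = ρ - 3 *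
  -- η`. The other terms exceed `ρ` by at most `η / N`, so the average `y₀` falls below `ρ - η / N`.
  set η : ℝ := (ρ - ‖h‖) / 4 with hη
  have hηpos : 0 < η := by rw [hη]; linarith
  obtain ⟨t, htW, htfin, hcov⟩ := Metric.finite_approx_of_totallyBounded hWtb η hηpos
  have hev : ∀ᶠ n in atTop, u n ∈ ⋃ w ∈ t, Metric.ball w η := by
    by_contra hcon
    obtain ⟨φ, hφ, hφO⟩ := extraction_of_frequently_atTop (not_eventually.mp hcon)
    obtain ⟨w, -, ψ, hψ, hlim⟩ := hcomp.tendsto_subseq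
      (x := fun n => u (φ n)) fun n => subset_closure (Set.mem_range_self _)
    have hwW : w ∈ W :=
      MapClusterPt.of_comp (hφ.comp hψ).tendsto_atTop hlim.mapClusterPt
    have hopen : IsOpen (⋃ w ∈ t, Metric.ball w η) :=
      isOpen_biUnion fun _ _ => Metric.isOpen_ball
    exact hopen.isClosed_compl.mem_of_tendsto hlim
      (Eventually.of_forall fun n => hφO (ψ n)) (hcov hwW)
  lift t to Finset X using htfin
  have htne : t.Nonempty := by
    obtain ⟨n, hn⟩ := hev.exists
    simp only [Set.mem_iUnion] at hn
    obtain ⟨w, hw, -⟩ := hn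
    exact ⟨w, hw⟩
  have hN : 0 < (t.card : ℝ) := by exact_mod_cast htne.card_pos
  set N : ℝ := (t.card : ℝ) with hNdef
  set y₀ : X := ∑ w ∈ t, N⁻¹ • w with hy₀
  have hy₀K : y₀ ∈ K := hK.sum_mem (fun _ _ => by positivity)
    (by rw [Finset.sum_const, nsmul_eq_mul, ← hNdef, mul_inv_cancel₀ hN.ne'])
    fun w hw => hu w (htW hw)
  have hall : ∀ᶠ n in atTop, ∀ w ∈ t, ‖u n - w - h‖ ≤ ρ + η / N :=
    (Finset.eventually_all t).mpr fun w hw =>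
      hle w (hu w (htW hw)) _ (by have := div_pos hηpos hN; linarith)
  obtain ⟨n, hn, hnall, hncov⟩ := ((hge y₀ hy₀K (ρ - η / N)
    (by have := div_pos hηpos hN; linarith)).and_eventually (hall.and hev)).exists
  simp only [Set.mem_iUnion, Metric.mem_ball] at hncov
  obtain ⟨w₀, hw₀, hclose⟩ := hncov
  have hw₀' : w₀ ∈ t := hw₀
  rw [dist_eq_norm] at hclose
  have hsmall : ‖u n - w₀ - h‖ ≤ ρ - 3 * η := by
    have := norm_sub_le (u n - w₀) h
    linarith
  have hsum : N • (u n - y₀ - h) = ∑ w ∈ t, (u n - w - h) := by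
    rw [hy₀, ← Finset.smul_sum, Finset.sum_sub_distrib, Finset.sum_sub_distrib, smul_sub, smul_sub,
      smul_inv_smul₀ hN.ne', Finset.sum_const, Finset.sum_const, hNdef, Nat.cast_smul_eq_nsmul,
      Nat.cast_smul_eq_nsmul]
  have h1 : N * ‖u n - y₀ - h‖ ≤ ∑ w ∈ t, ‖u n - w - h‖ := by
    rw [← Real.norm_of_nonneg hN.le, ← norm_smul, hsum]
    exact norm_sum_le _ _
  have h2 : ∑ w ∈ t, ‖u n - w - h‖ ≤ N * (ρ + η / N) - 3 * η := by
    classical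
    rw [← Finset.add_sum_erase t _ hw₀']
    have h3 : ∑ w ∈ t.erase w₀, ‖u n - w - h‖ ≤ ∑ w ∈ t.erase w₀, (ρ + η / N) :=
      Finset.sum_le_sum fun w hw => hnall w (Finset.mem_of_mem_erase hw)
    have h4 : (ρ + η / N) + ∑ w ∈ t.erase w₀, (ρ + η / N) = N * (ρ + η / N) := by
      rw [Finset.add_sum_erase t (fun _ => ρ + η / N) hw₀', Finset.sum_const, nsmul_eq_mul]
    have := div_pos hηpos hN
    linarith
  have h5 : N * (ρ - η / N) < N * ‖u n - y₀ - h‖ := mul_lt_mul_of_pos_left hn hN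
  have h6 : N * (η / N) = η := mul_div_cancel₀ _ hN.ne'
  rw [mul_sub, h6] at h5
  rw [mul_add, h6] at h2
  linarith

/-- The uniform Kadec-Klee property for balls of arbitrary centre and radius close to `ρ`. -/
theorem IsUKK.exists_norm_sub_le (hX : IsUKK X) {p : ℕ → X} {z : X}
    (hp : Tendsto (fun j => toWeakSpace ℝ X (p j)) atTop (𝓝 (toWeakSpace ℝ X z)))
    {s : ℝ} (hs : 0 < s) (hsep : ∀ i j, i ≠ j → s ≤ ‖p i - p j‖) {ρ : ℝ} (hρ : 0 < ρ) :
    ∃ ρ' < ρ, ∃ R > ρ, ∀ v, (∀ᶠ j in atTop, ‖p j - v‖ ≤ R) → ‖z - v‖ ≤ ρ' := by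
  obtain ⟨δ₀, hδ₀, H⟩ := hX (s / (2 * ρ)) (by positivity)
  set δ : ℝ := min δ₀ 1 with hδdef
  have hδ : 0 < δ := lt_min hδ₀ one_pos
  have hδ1 : δ ≤ 1 := min_le_right _ _
  -- Chosen so that `(1 - δ) * R < ρ < R`, while `R < 2 * ρ` keeps the separation above `s / (2 *
  -- ρ)` after rescaling by `R⁻¹`.
  set R : ℝ := ρ * (1 + δ / 2) with hR
  have hRρ : ρ < R := by rw [hR]; nlinarith
  have hRpos : 0 < R := hρ.trans hRρ
  have hR2 : R < 2 * ρ := by rw [hR]; nlinarith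
  refine ⟨(1 - δ) * R, ?_, R, hRρ, fun v hv => ?_⟩
  · rw [hR]
    nlinarith [mul_pos hρ hδ, mul_pos (mul_pos hρ hδ) hδ]
  obtain ⟨J, hJ⟩ := eventually_atTop.mp hv
  have key : ‖R⁻¹ • (z - v)‖ ≤ 1 - δ₀ := by
    refine H (fun j => R⁻¹ • (p (j + J) - v)) _ (fun j => ?_) ?_ ?_
    · rw [norm_smul, norm_inv, Real.norm_of_nonneg hRpos.le, inv_mul_le_one₀ hRpos]
      exact hJ _ (Nat.le_add_left _ _)
    · have h1 := (((tendsto_add_atTop_iff_nat J).mpr hp).sub_const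
        (toWeakSpace ℝ X v)).const_smul R⁻¹
      simpa only [map_smul, map_sub] using h1
    · refine lt_of_lt_of_le (div_lt_div_of_pos_left hs hRpos hR2) ?_
      refine le_csInf ⟨_, 0, 1, zero_ne_one, rfl⟩ ?_
      rintro _ ⟨i, j, hij, rfl⟩
      rw [← smul_sub, sub_sub_sub_cancel_right, norm_smul, norm_inv,
        Real.norm_of_nonneg hRpos.le, div_eq_inv_mul]
      gcongr
      exact hsep _ _ (by omega)
  rw [norm_smul, norm_inv, Real.norm_of_nonneg hRpos.le, inv_mul_le_iff₀ hRpos] at key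
  calc ‖z - v‖ ≤ R * (1 - δ₀) := key
    _ ≤ R * (1 - δ) := by gcongr; exact min_le_left _ _
    _ = (1 - δ) * R := mul_comm _ _

end AsymptoticCentre

/-! ### Convergence of an orbit to its starting point -/

section MinimalSets

variable {X : Type*} [NormedAddCommGroup X]

/-- A limsup in `n` ignores the shift by `m`, so the asymptotic distance from `v m` is at most `κ m
* r + e m`, which tends to `r`. -/
theorem eventually_mem_asymptoticSublevel {u v : ℕ → X} {y h : X} {κ e : ℕ → ℝ}
    (hκ : Tendsto κ atTop (𝓝 1)) (he : Tendsto e atTop (𝓝 0))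
    (hle : ∀ m n, ‖u (n + m) - v m - h‖ ≤ κ m * ‖u n - y - h‖ + e m)
    {r c : ℝ} (hy : y ∈ asymptoticSublevel u h r) (hc : r < c) :
    ∀ᶠ m in atTop, v m ∈ asymptoticSublevel u h c := by
  have hlim : Tendsto (fun m => κ m * ((r + c) / 2) + e m) atTop (𝓝 ((r + c) / 2)) := by
    simpa using (hκ.mul_const ((r + c) / 2)).add he
  filter_upwards [hlim.eventually_le_const (show (r + c) / 2 < c by linarith),
    hκ.eventually_const_le zero_lt_one] with m hm hκm c' hc'
  have h1 := hy ((r + c) / 2) (by linarith)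
  have h2 : ∀ᶠ n in atTop, ‖u (n + m) - v m - h‖ ≤ c' := h1.mono fun n hn =>
    calc ‖u (n + m) - v m - h‖ ≤ κ m * ‖u n - y - h‖ + e m := hle m n
      _ ≤ κ m * ((r + c) / 2) + e m := by gcongr
      _ ≤ c' := hm.trans (le_of_lt hc')
  rw [eventually_atTop] at h2 ⊢
  obtain ⟨N, hN⟩ := h2
  refine ⟨N + m, fun n hn => ?_⟩
  have := hN (n - m) (by omega)
  rwa [Nat.sub_add_cancel (by omega)] at this

variable [NormedSpace ℝ X]

/-- On a minimal set the asymptotic distance to an orbit is constant. -/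
theorem subset_asymptoticSublevel_of_minimal {A K : Set X} {a : X → ℕ → X} {h : X}
    (hK : Minimal (· ∈ omegaClosedSubsets A a) K)
    (hasymp : ∀ y ∈ A, ∃ κ e : ℕ → ℝ, Tendsto κ atTop (𝓝 1) ∧ Tendsto e atTop (𝓝 0) ∧
      ∀ x ∈ A, ∀ m n, ‖a x (n + m) - a y m - h‖ ≤ κ m * ‖a x n - y - h‖ + e m)
    {x y : X} (hx : x ∈ K) (hy : y ∈ K) {r : ℝ} (hyr : y ∈ asymptoticSublevel (a x) h r) :
    K ⊆ asymptoticSublevel (a x) h r := by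
  obtain ⟨hKA, hKne, hKc, hKconv, hKω⟩ := hK.prop
  -- The sublevel set is weakly closed and almost absorbs orbits, so cutting `K` by it stays in the
  -- family and minimality forbids a proper cut.
  have hmem : K ∩ asymptoticSublevel (a x) h r ∈ omegaClosedSubsets A a := by
    refine ⟨Set.inter_subset_left.trans hKA, ⟨y, hy, hyr⟩,
      hKc.inter (isClosed_asymptoticSublevel _ _ _),
      hKconv.inter (convex_asymptoticSublevel _ _ _), ?_⟩
    rintro w ⟨hwK, hwr⟩ z hz
    refine ⟨hKω w hwK z hz, fun c hc => ?_⟩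
    obtain ⟨κ, e, hκ, he, hle⟩ := hasymp w (hKA hwK)
    have hc' : r < (r + c) / 2 := by linarith [show r < c from hc]
    have hz' := (convex_asymptoticSublevel (a x) h ((r + c) / 2)).mem_of_mapClusterPt_toWeakSpace
      (isClosed_asymptoticSublevel _ _ _)
      (eventually_mem_asymptoticSublevel hκ he (hle x (hKA hx)) hwr hc') hz
    exact hz' c (by linarith [show r < c from hc])
  exact (hK.le_of_le hmem Set.inter_subset_left).trans Set.inter_subset_right

/-- Fixed points of asymptotic type for orbits that are asymptotically nonexpansive with respect
to the gauge `(x, y) ↦ ‖x - y - h‖`. -/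
theorem IsNUC.exists_tendsto_self [CompleteSpace X] (hX : IsNUC X) {A : Set X} {h : X}
    (hA : A.Nonempty) (hAc : IsClosed A) (hAconv : Convex ℝ A) (hAb : Bornology.IsBounded A)
    (hsymm : ∀ x ∈ A, ∀ y ∈ A, ‖x - y - h‖ = ‖y - x - h‖)
    (hlower : ∀ x ∈ A, ∀ y ∈ A, ‖h‖ ≤ ‖x - y - h‖)
    (huc : ∀ u : ℕ → X, ∀ y ∈ A, (∀ n, u n ∈ A) →
      Tendsto (fun n => ‖u n - y - h‖) atTop (𝓝 ‖h‖) → Tendsto u atTop (𝓝 y))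
    {a : X → ℕ → X} (ha : ∀ x ∈ A, ∀ n, a x n ∈ A)
    (hasymp : ∀ y ∈ A, ∃ κ e : ℕ → ℝ, Tendsto κ atTop (𝓝 1) ∧ Tendsto e atTop (𝓝 0) ∧
      ∀ x ∈ A, ∀ m n, ‖a x (n + m) - a y m - h‖ ≤ κ m * ‖a x n - y - h‖ + e m) :
    ∃ x ∈ A, Tendsto (a x) atTop (𝓝 x) := by
  obtain ⟨K, hK⟩ := hX.1.exists_minimal_omegaClosed hA hAc hAconv hAb ha
  obtain ⟨hKA, ⟨x, hx⟩, hKc, hKconv, hKω⟩ := hK.prop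
  have hxA := hKA hx
  have hub : IsBoundedUnder (· ≤ ·) atTop fun n => ‖a x n - x - h‖ := by
    obtain ⟨C, hC⟩ := hAb.exists_norm_le
    refine isBoundedUnder_of ⟨C + ‖x‖ + ‖h‖, fun n => ?_⟩
    have h1 := norm_sub_le (a x n - x) h
    have h2 := norm_sub_le (a x n) x
    have h3 := hC _ (ha x hxA n)
    linarith
  have hlb : IsBoundedUnder (· ≥ ·) atTop fun n => ‖a x n - x - h‖ :=
    isBoundedUnder_of ⟨0, fun n => norm_nonneg _⟩
  set ρ : ℝ := limsup (fun n => ‖a x n - x - h‖) atTop with hρ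
  have hle : K ⊆ asymptoticSublevel (a x) h ρ :=
    subset_asymptoticSublevel_of_minimal hK hasymp hx hx fun c hc =>
      (eventually_lt_of_limsup_lt hc hub).mono fun _ => le_of_lt
  have hge : ∀ y ∈ K, ∀ c < ρ, ∃ᶠ n in atTop, c < ‖a x n - y - h‖ := by
    intro y hy c hc hcon
    have hyc : y ∈ asymptoticSublevel (a x) h c := fun c' hc' =>
      hcon.mono fun n hn => (not_lt.mp hn).trans (le_of_lt hc')
    have hxc := subset_asymptoticSublevel_of_minimal hK hasymp hx hy hyc hx
    have h1 : ρ ≤ (c + ρ) / 2 :=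
      limsup_le_of_le hlb.isCoboundedUnder_le (hxc _ (by show c < _; linarith))
    linarith
  refine ⟨x, hxA, ?_⟩
  rcases le_or_gt ρ ‖h‖ with hρh | hρh
  · refine huc _ x hxA (ha x hxA) ?_
    refine tendsto_order.mpr ⟨fun c hc => Eventually.of_forall fun n =>
      hc.trans_le (hlower _ (ha x hxA n) _ hxA), fun c hc => ?_⟩
    exact eventually_lt_of_limsup_lt (hρh.trans_lt hc) hub
  exfalso
  have hρpos : 0 < ρ := (norm_nonneg h).trans_lt hρh
  have hntb : ¬ TotallyBounded (Set.range (a x)) :=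
    not_totallyBounded_of_asymptotically_equidistant hKconv
      (fun w hw => hKω x hx w (hw.continuousAt_comp (toWeakSpaceCLM ℝ X).continuous.continuousAt))
      hρh (fun y hy => hle hy) hge
  obtain ⟨s, hs, φ, hφ, hsep⟩ := exists_separated_of_not_totallyBounded hntb
  obtain ⟨z, ψ, hψ, hz⟩ := hX.1.exists_subseq_tendsto_weak (u := fun j => a x (φ j))
    (hAb.subset (by rintro _ ⟨j, rfl⟩; exact ha x hxA _))
  have hφψ : Tendsto (φ ∘ ψ) atTop atTop := hφ.comp hψ.tendsto_atTop
  have hzK : z ∈ K := hKω x hx z (MapClusterPt.of_comp hφψ hz.mapClusterPt)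
  obtain ⟨ρ', hρ', R, hR, hukk⟩ := hX.2.exists_norm_sub_le hz hs (fun i j hij => by
    rw [← dist_eq_norm]; exact hsep _ _ (hψ.injective.ne hij)) hρpos
  obtain ⟨κ, e, hκ, he, hle'⟩ := hasymp x hxA
  have hev := eventually_mem_asymptoticSublevel hκ he (hle' x hxA) (hle hx)
    (show ρ < (ρ + R) / 2 by linarith)
  -- Apply the Kadec-Klee estimate with centre `a x n + h`, for an `n` at which `z` is still farther
  -- than `ρ'`; symmetry of the gauge exposes the contradiction.
  obtain ⟨n, hn, hn'⟩ := ((hge z hzK ρ' hρ').and_eventually hev).exists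
  have h1 : ∀ᶠ j in atTop, ‖a x (φ (ψ j)) - (a x n + h)‖ ≤ R :=
    (hφψ.eventually (hn' R (by show _ < R; linarith))).mono fun j hj => by
      rwa [← sub_sub]
  have h2 := hukk _ h1
  rw [← sub_sub, hsymm z (hKA hzK) _ (ha x hxA n)] at h2
  linarith

end MinimalSets

/-! ### Cyclic maps and their orbits projected to `A` -/

section CyclicMaps

variable {X : Type*}

theorem mapsTo_iterate_even {A B : Set X} {T : X → X} (hTA : Set.MapsTo T A B)
    (hTB : Set.MapsTo T B A) {n : ℕ} (hn : Even n) : Set.MapsTo T^[n] A A := by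
  obtain ⟨m, rfl⟩ := hn
  rw [← two_mul, Function.iterate_mul]
  exact Set.MapsTo.iterate (hTB.comp hTA) m

theorem mapsTo_iterate_odd {A B : Set X} {T : X → X} (hTA : Set.MapsTo T A B)
    (hTB : Set.MapsTo T B A) {n : ℕ} (hn : ¬ Even n) : Set.MapsTo T^[n] A B := by
  obtain ⟨m, rfl⟩ := Nat.not_even_iff_odd.mp hn
  intro x hx
  have h1 := hTA (mapsTo_iterate_even hTA hTB (even_two_mul m) hx)
  rwa [← Function.iterate_succ_apply' T] at h1

variable [NormedAddCommGroup X]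


theorem setDist_le_norm_sub {A B : Set X} {x y : X} (hx : x ∈ A) (hy : y ∈ B) :
    setDist A B ≤ ‖x - y‖ :=
  csInf_le ⟨0, by rintro _ ⟨a, -, b, -, rfl⟩; exact norm_nonneg _⟩ ⟨x, hx, y, hy, rfl⟩

theorem IsTranslate.add_mem {A B : Set X} {h : X} (hAB : IsTranslate A B h) {x : X} (hx : x ∈ A) :
    x + h ∈ B := hAB ▸ ⟨x, hx, rfl⟩

theorem IsTranslate.sub_mem {A B : Set X} {h : X} (hAB : IsTranslate A B h) {y : X} (hy : y ∈ B) :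
    y - h ∈ A := by
  rw [IsTranslate] at hAB
  subst hAB
  obtain ⟨x, hx, rfl⟩ := hy
  simpa using hx

/-- Iterating a proximal-point map moves `x₀` by `n • h` up to an error `n * dist(A, B)`. Were `‖h‖`
larger than the distance, the displacement would grow without bound inside the bounded set `A`. -/
theorem IsTranslate.norm_eq_setDist [NormedSpace ℝ X] {A B : Set X} {h : X}
    (hAB : IsTranslate A B h) (hsharp : IsSharpProximalPair A B) (hA : A.Nonempty)
    (hAb : Bornology.IsBounded A) : ‖h‖ = setDist A B := by
  obtain ⟨x₀, hx₀⟩ := hA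
  apply le_antisymm
  swap
  · have := setDist_le_norm_sub hx₀ (hAB.add_mem hx₀)
    simpa using this
  have hprox : ∀ x ∈ A, ∃ x' ∈ A, ‖x - x' - h‖ = setDist A B := by
    intro x hx
    obtain ⟨p, ⟨⟨-, hp⟩, hd, -⟩, -⟩ := hsharp x hx (x + h) (hAB.add_mem hx)
    refine ⟨p.2 - h, hAB.sub_mem hp, ?_⟩
    rw [← hd]
    congr 1
    abel
  choose! f hf hfd using hprox
  have hmem : ∀ n, f^[n] x₀ ∈ A := fun n => (show Set.MapsTo f A A from hf).iterate n hx₀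
  have hbound : ∀ n : ℕ, ‖x₀ - f^[n] x₀ - (n : ℝ) • h‖ ≤ n * setDist A B := by
    intro n
    induction n with
    | zero => simp
    | succ n ih =>
      have heq : x₀ - f^[n + 1] x₀ - ((n + 1 : ℕ) : ℝ) • h =
          (x₀ - f^[n] x₀ - (n : ℝ) • h) + (f^[n] x₀ - f (f^[n] x₀) - h) := by
        rw [Function.iterate_succ_apply', Nat.cast_succ, add_smul, one_smul]
        abel
      rw [heq]
      refine (norm_add_le _ _).trans ?_
      rw [hfd _ (hmem n)]
      push_cast
      linarith
  obtain ⟨C, hC⟩ := hAb.exists_norm_le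
  by_contra! hlt
  obtain ⟨n, hn⟩ := exists_nat_gt (2 * C / (‖h‖ - setDist A B))
  rw [div_lt_iff₀ (by linarith)] at hn
  have h1 : (n : ℝ) * ‖h‖ ≤ ‖x₀ - f^[n] x₀‖ + n * setDist A B := by
    have h2 := norm_sub_le (x₀ - f^[n] x₀) (x₀ - f^[n] x₀ - (n : ℝ) • h)
    rw [sub_sub_cancel, norm_smul, Real.norm_of_nonneg n.cast_nonneg] at h2
    linarith [hbound n]
  have h3 := norm_sub_le x₀ (f^[n] x₀)
  have h4 := hC _ hx₀
  have h5 := hC _ (hmem n)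
  linarith

/-- The orbit of `x ∈ A` under the cyclic map `T`, with its odd terms translated back to `A`. -/
def projectedOrbit (T : X → X) (h x : X) (n : ℕ) : X :=
  if Even n then T^[n] x else T^[n] x - h

/-- The orbit of `x + h ∈ B` under the cyclic map `T`, with its even terms translated back
to `A`. -/
def projectedDualOrbit (T : X → X) (h x : X) (n : ℕ) : X :=
  if Even n then T^[n] (x + h) - h else T^[n] (x + h)

section Orbit

variable {A B : Set X} {h : X} {T : X → X}

theorem projectedOrbit_mem (hAB : IsTranslate A B h) (hTA : Set.MapsTo T A B)
    (hTB : Set.MapsTo T B A) {x : X} (hx : x ∈ A) (n : ℕ) : projectedOrbit T h x n ∈ A := by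
  unfold projectedOrbit
  split_ifs with hn
  · exact mapsTo_iterate_even hTA hTB hn hx
  · exact hAB.sub_mem (mapsTo_iterate_odd hTA hTB hn hx)

theorem projectedDualOrbit_mem (hAB : IsTranslate A B h) (hTA : Set.MapsTo T A B)
    (hTB : Set.MapsTo T B A) {x : X} (hx : x ∈ A) (n : ℕ) : projectedDualOrbit T h x n ∈ A := by
  unfold projectedDualOrbit
  split_ifs with hn
  · exact hAB.sub_mem (mapsTo_iterate_even hTB hTA hn (hAB.add_mem hx))
  · exact mapsTo_iterate_odd hTB hTA hn (hAB.add_mem hx)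

variable (hAB : IsTranslate A B h) (hTA : Set.MapsTo T A B) (hTB : Set.MapsTo T B A)
  (hsymm : ∀ x ∈ A, ∀ y ∈ A, ‖x - y - h‖ = ‖y - x - h‖)

include hAB hTA hTB hsymm

/-- When `m` is odd the two iterates have exchanged sides and `h` enters with the opposite sign;
symmetry of the gauge repairs this. -/
theorem norm_projectedOrbit_sub_of_even {x y : X} (hx : x ∈ A) (hy : y ∈ A) (m : ℕ) {n : ℕ}
    (hn : Even n) : ‖projectedOrbit T h x (n + m) - projectedDualOrbit T h y m - h‖ =
      ‖T^[m] (T^[n] x) - T^[m] (y + h)‖ := by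
  have h1 := hsymm _ (projectedOrbit_mem hAB hTA hTB hx (n + m)) _
    (projectedDualOrbit_mem hAB hTA hTB hy m)
  rw [← Function.iterate_add_apply, add_comm m n]
  by_cases hm : Even m
  · rw [projectedOrbit, projectedDualOrbit, if_pos (hn.add hm), if_pos hm]
    congr 1
    abel
  · have hnm : ¬ Even (n + m) := by simp [Nat.even_add, hn, hm]
    rw [h1, projectedOrbit, projectedDualOrbit, if_neg hnm, if_neg hm,
      norm_sub_rev (T^[n + m] x)]
    congr 1
    abel

theorem norm_projectedOrbit_sub_of_odd {x y : X} (hx : x ∈ A) (hy : y ∈ A) (m : ℕ) {n : ℕ}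
    (hn : ¬ Even n) : ‖projectedOrbit T h x (n + m) - projectedOrbit T h y m - h‖ =
      ‖T^[m] (T^[n] x) - T^[m] y‖ := by
  have h1 := hsymm _ (projectedOrbit_mem hAB hTA hTB hx (n + m)) _
    (projectedOrbit_mem hAB hTA hTB hy m)
  rw [← Function.iterate_add_apply, add_comm m n]
  by_cases hm : Even m
  · have hnm : ¬ Even (n + m) := by simp [Nat.even_add, hn, hm]
    rw [h1, projectedOrbit, projectedOrbit, if_neg hnm, if_pos hm,
      norm_sub_rev (T^[n + m] x)]
    congr 1
    abel
  · have hnm : Even (n + m) := by simp [Nat.even_add, hn, hm]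
    rw [projectedOrbit, projectedOrbit, if_pos hnm, if_neg hm]
    congr 1
    abel

/-- The hypothesis on `T` compares only points on opposite sides. For odd `n`, `T^[n] x` lies in `B`
and is compared with `y`; for even `n` its partner must be `y + h`, and returning from the dual
orbit costs the last term. -/
theorem norm_projectedOrbit_sub_le {k : ℕ → ℝ}
    (hk : ∀ n, ∀ x ∈ A, ∀ y ∈ B, ‖T^[n] x - T^[n] y‖ ≤ k n * ‖x - y‖)
    {x y : X} (hx : x ∈ A) (hy : y ∈ A) (m n : ℕ) :
    ‖projectedOrbit T h x (n + m) - projectedOrbit T h y m - h‖ ≤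
      k m * ‖projectedOrbit T h x n - y - h‖ +
        ‖projectedOrbit T h y m - projectedDualOrbit T h y m‖ := by
  by_cases hn : Even n
  · have h1 := norm_sub_le (projectedOrbit T h x (n + m) - projectedDualOrbit T h y m - h)
      (projectedOrbit T h y m - projectedDualOrbit T h y m)
    rw [norm_projectedOrbit_sub_of_even hAB hTA hTB hsymm hx hy m hn] at h1
    have h2 := hk m _ (mapsTo_iterate_even hTA hTB hn hx) _ (hAB.add_mem hy)
    have h3 : projectedOrbit T h x n - y - h = T^[n] x - (y + h) := by
      rw [projectedOrbit, if_pos hn, sub_sub]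
    rw [h3]
    refine le_trans (le_of_eq ?_) (h1.trans (add_le_add_left h2 _))
    congr 1
    abel
  · have h2 := hk m _ hy _ (mapsTo_iterate_odd hTA hTB hn hx)
    have h3 : ‖projectedOrbit T h x n - y - h‖ = ‖y - T^[n] x‖ := by
      rw [hsymm _ (projectedOrbit_mem hAB hTA hTB hx n) _ hy, projectedOrbit, if_neg hn]
      congr 1
      abel
    rw [norm_projectedOrbit_sub_of_odd hAB hTA hTB hsymm hx hy m hn, norm_sub_rev, h3]
    linarith [norm_nonneg (projectedOrbit T h y m - projectedDualOrbit T h y m)]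

/-- Both orbits are asymptotically proximal to the same points of `B`, the dual orbit shifted by
`h`, so UC merges them. -/
theorem tendsto_norm_projectedOrbit_sub_dual {k : ℕ → ℝ} (hUC : HasPropertyUC A B)
    (hd : ‖h‖ = setDist A B) (hk1 : Tendsto k atTop (𝓝 1))
    (hk : ∀ n, ∀ x ∈ A, ∀ y ∈ B, ‖T^[n] x - T^[n] y‖ ≤ k n * ‖x - y‖) {y : X} (hy : y ∈ A) :
    Tendsto (fun m => ‖projectedOrbit T h y m - projectedDualOrbit T h y m‖) atTop (𝓝 0) := by
  have hmem := projectedDualOrbit_mem hAB hTA hTB hy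
  refine hUC _ _ (fun m => projectedDualOrbit T h y m + h) (projectedOrbit_mem hAB hTA hTB hy)
    hmem (fun m => hAB.add_mem (hmem m)) ?_ ?_
  · have hlim : Tendsto (fun m => k m * ‖h‖) atTop (𝓝 (setDist A B)) := by
      simpa [hd] using hk1.mul_const ‖h‖
    refine tendsto_of_tendsto_of_tendsto_of_le_of_le tendsto_const_nhds hlim
      (fun m => setDist_le_norm_sub (projectedOrbit_mem hAB hTA hTB hy m) (hAB.add_mem (hmem m)))
      fun m => ?_
    have h1 := norm_projectedOrbit_sub_of_even hAB hTA hTB hsymm hy hy m (n := 0) Even.zero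
    have h2 := hk m y hy _ (hAB.add_mem hy)
    rw [zero_add, Function.iterate_zero_apply] at h1
    rw [← h1] at h2
    simpa [sub_sub] using h2
  · simp [hd]

end Orbit

/-- A point to which its own projected orbit converges is a best proximity point. -/
theorem map_eq_add_of_tendsto_projectedOrbit {A B : Set X} {h : X} {T : X → X}
    (hTA : Set.MapsTo T A B) (hTB : Set.MapsTo T B A) (hT : ContinuousOn T (A ∪ B)) {x : X}
    (hx : x ∈ A) (hlim : Tendsto (projectedOrbit T h x) atTop (𝓝 x)) : T x = x + h := by
  have h2 : Tendsto (fun n : ℕ => 2 * n) atTop atTop :=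
    tendsto_id.const_mul_atTop' two_pos
  have heven : Tendsto (fun n : ℕ => T^[2 * n] x) atTop (𝓝 x) :=
    (hlim.comp h2).congr fun n => by simp [projectedOrbit]
  have hodd : Tendsto (fun n : ℕ => T (T^[2 * n] x)) atTop (𝓝 (x + h)) := by
    refine ((hlim.comp ((tendsto_add_atTop_nat 1).comp h2)).add_const h).congr fun n => ?_
    simp [projectedOrbit, ← Function.iterate_succ_apply' T]
  have hcont : Tendsto (fun n : ℕ => T (T^[2 * n] x)) atTop (𝓝 (T x)) :=
    (hT x (Or.inl hx)).tendsto.comp (tendsto_nhdsWithin_iff.mpr ⟨heven,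
      Eventually.of_forall fun n => Or.inl (mapsTo_iterate_even hTA hTB (even_two_mul n) hx)⟩)
  exact tendsto_nhds_unique hcont hodd

end CyclicMaps

end BestProximity
end

theorem theorem3p5 {X : Type*} [NormedAddCommGroup X] [NormedSpace ℝ X] [CompleteSpace X]
    (hX : BestProximity.IsNUC X)
    (A B : Set X)
    (hA : A.Nonempty) (hB : B.Nonempty)
    (hAbdd : Bornology.IsBounded A) (hBbdd : Bornology.IsBounded B)
    (hAclosed : IsClosed A) (hBclosed : IsClosed B)
    (hAconv : Convex ℝ A) (hBconv : Convex ℝ B)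
    (hAB : BestProximity.IsProximalParallelPair A B)
    (hrect : BestProximity.HasRectangleProperty A B)
    (hUC : BestProximity.HasPropertyUC A B)
    (T : X → X)
    (hTcont : ContinuousOn T (A ∪ B))
    (hTasymp : BestProximity.IsAsympRelNonexpansive A B T)
    (hTA : Set.MapsTo T A B) (hTB : Set.MapsTo T B A) :
    ∃ x ∈ A ∪ B, ‖x - T x‖ = BestProximity.setDist A B := by
  open BestProximity in
  obtain ⟨h, hh, hrec⟩ := hrect
  obtain ⟨k, -, hk1, hk⟩ := hTasymp
  have hd : ‖h‖ = setDist A B := hh.norm_eq_setDist hAB.1 hA hAbdd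
  have hsymm : ∀ x ∈ A, ∀ y ∈ A, ‖x - y - h‖ = ‖y - x - h‖ := by
    intro x hx y hy
    rw [sub_sub, norm_sub_rev, ← hrec x hx y hy, sub_sub, norm_sub_rev y]
  obtain ⟨x, hx, hlim⟩ := hX.exists_tendsto_self (h := h) (a := projectedOrbit T h) hA hAclosed
    hAconv hAbdd hsymm
    (fun x hx y hy => by
      rw [hd, sub_sub]
      exact setDist_le_norm_sub hx (hh.add_mem hy))
    (fun u y hy hu hlim => by
      refine tendsto_iff_norm_sub_tendsto_zero.mpr ?_
      refine hUC u (fun _ => y) (fun _ => y + h) hu (fun _ => hy) (fun _ => hh.add_mem hy) ?_ ?_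
      · simpa only [sub_sub, hd] using hlim
      · simp [hd])
    (fun x hx => projectedOrbit_mem hh hTA hTB hx)
    (fun y hy => ⟨k, _, hk1,
      tendsto_norm_projectedOrbit_sub_dual hh hTA hTB hsymm hUC hd hk1 hk hy,
      fun x hx m n => norm_projectedOrbit_sub_le hh hTA hTB hsymm hk hx hy m n⟩)
  refine ⟨x, Or.inl hx, ?_⟩
  rw [map_eq_add_of_tendsto_projectedOrbit hTA hTB hTcont hx hlim, sub_add_cancel_left, norm_neg,
    hd]
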